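/- For $|q|<1$ let $$\varphi(q) = \sum_{n=-\infty}^{\infty} q^{n^2}$$ be Ramanujan's theta function, i.e. $\varphi(q)=f(q,q)$, where $f(a,b)=\sum_{n=-\infty}^{\infty} a^{n(n+1)/2}b^{n(n-1)/2}$ for $|ab|<1$. Then $$\varphi\big(e^{-7\pi\sqrt7}\big) = 7^{-3/4}\,\varphi\big(e^{-\pi\sqrt7}\big)\left\{1 + \left(\frac{\cos\frac{\pi}{7}}{2\cos^2\frac{2\pi}{7}}\right)^{2/7} + \left(\frac{\cos\frac{2\pi}{7}}{2\cos^2\frac{3\pi}{7}}\right)^{2/7} + \left(\frac{\cos\frac{3\pi}{7}}{2\cos^2\frac{\pi}{7}}\right)^{2/7}\right\},$$ where all the fractional powers are the positive real powers of positive real numbers. -/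

import Mathlib

/-- Ramanujan's general theta function
`f(a, b) = ∑_{n ∈ ℤ} a^{n(n+1)/2} b^{n(n-1)/2}`, for `‖a * b‖ < 1`.
Both exponents are nonnegative integers, so the integer divisions are exact. -/
noncomputable def ramanujanF {K : Type*} [NormedField K] (a b : K) : K :=
  ∑' n : ℤ, a ^ (n * (n + 1) / 2) * b ^ (n * (n - 1) / 2)

/-- Ramanujan's theta function `φ(q) = f(q, q)`, for `‖q‖ < 1`. -/
noncomputable def ramanujanPhi {K : Type*} [NormedField K] (q : K) : K :=
  ramanujanF q q

theorem ramanujanF_term_self {K : Type*} [NormedField K] (q : K) (n : ℤ) :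
    q ^ (n * (n + 1) / 2) * q ^ (n * (n - 1) / 2) = q ^ (n ^ 2).natAbs := by
  have h1 : 2 * (n * (n + 1) / 2) = n * (n + 1) :=
    Int.mul_ediv_cancel' (Int.even_mul_succ_self n).two_dvd
  have h2 : 2 * (n * (n - 1) / 2) = n * (n - 1) :=
    Int.mul_ediv_cancel' (Int.even_mul_pred_self n).two_dvd
  have h0 : (0 : ℤ) ≤ n * (n + 1) := by
    rcases le_or_gt 0 n with h | h
    · positivity
    · nlinarith
  have h0' : (0 : ℤ) ≤ n * (n - 1) := by
    rcases le_or_gt n 0 with h | h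
    · nlinarith
    · nlinarith
  obtain ⟨k, hk⟩ := Int.eq_ofNat_of_zero_le (show 0 ≤ n * (n + 1) / 2 by omega)
  obtain ⟨l, hl⟩ := Int.eq_ofNat_of_zero_le (show 0 ≤ n * (n - 1) / 2 by omega)
  have h3 : n ^ 2 = ((k + l : ℕ) : ℤ) := by
    push_cast
    rw [← hk, ← hl]
    nlinarith
  rw [hk, hl, h3, zpow_natCast, zpow_natCast, ← pow_add, Int.natAbs_natCast]

/-- The series defining `φ(q)` converges for `‖q‖ < 1`, and its sum is `∑_{n ∈ ℤ} q^{n²}`. -/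
theorem hasSum_ramanujanPhi {K : Type*} [NormedField K] [CompleteSpace K] {q : K}
    (hq : ‖q‖ < 1) : HasSum (fun n : ℤ => q ^ (n ^ 2).natAbs) (ramanujanPhi q) := by
  have hs : Summable (fun n : ℤ => q ^ (n ^ 2).natAbs) := by
    have hg : Summable (fun n : ℤ => ‖q‖ ^ n.natAbs) := by
      refine Summable.of_nat_of_neg ?_ ?_ <;>
        simpa using summable_geometric_of_lt_one (norm_nonneg q) hq
    refine Summable.of_norm_bounded hg fun n => ?_
    rw [norm_pow]
    refine pow_le_pow_of_le_one (norm_nonneg q) hq.le ?_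
    rw [Int.natAbs_pow]
    exact Nat.le_self_pow two_ne_zero _
  have he : ramanujanPhi q = ∑' n : ℤ, q ^ (n ^ 2).natAbs :=
    tsum_congr fun n => ramanujanF_term_self q n
  rw [he]
  exact hs.hasSum

/-! Let s = π/(7√7) and let θ_a be the sum of exp(-s k²) over k ≡ a mod 7. Inversion and dissection
modulo 7 turn the quotient of the two values of φ into 7^(-3/4) (1 + 2(x + y + z)), where x, y, z
are θ₁/θ₀, θ₂/θ₀, θ₃/θ₀.

Two sources of algebra determine x, y, z. Rotating a planar lattice by 45°
(`gaussSeries_mul_gaussSeries`) makes the products θ_{i+j} θ_{i-j} a Gram matrix of plane vectors,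
so its 3×3 minors vanish (`gaussSeries_seven_relations`). A quaternion of norm 7 expresses
φ(e^{-7s})⁴ through the θ_a (`gaussSeries_pow_four_eq`), and inversion equates it to 7 θ₀⁴.

Together these force xyz = 1/8 and make 16x³y, 16y³z, 16z³x the roots of r³ - 6r² + 5r - 1, which
are the numbers 1/(4cos²(kπ/7)). A relation that is not symmetric fixes their cyclic order, and
seventh roots recover x, y, z. -/

/-! ### Gaussian sums over arithmetic progressions -/

/-- The one-dimensional Gaussian sum `∑_{n ∈ ℤ} exp (-s (m n + a)²)` over an arithmetic
progression. -/
noncomputable def gaussSeries (s : ℝ) (m a : ℤ) : ℝ :=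
  ∑' n : ℤ, Real.exp (-s * ((m * n + a : ℤ) : ℝ) ^ 2)

theorem exp_neg_pow_natAbs_sq (s : ℝ) (n : ℤ) :
    Real.exp (-s) ^ (n ^ 2).natAbs = Real.exp (-s * (n : ℝ) ^ 2) := by
  rw [← Real.exp_nat_mul, Nat.cast_natAbs, abs_of_nonneg (sq_nonneg n)]
  push_cast
  ring_nf

theorem norm_exp_neg_lt_one {s : ℝ} (hs : 0 < s) : ‖Real.exp (-s)‖ < 1 := by
  rw [Real.norm_eq_abs, Real.abs_exp, Real.exp_lt_one_iff]
  linarith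

theorem summable_exp_neg_mul_int_sq {s : ℝ} (hs : 0 < s) :
    Summable fun n : ℤ => Real.exp (-s * (n : ℝ) ^ 2) := by
  simpa only [exp_neg_pow_natAbs_sq] using (hasSum_ramanujanPhi (norm_exp_neg_lt_one hs)).summable

theorem ramanujanPhi_exp_neg {s : ℝ} (hs : 0 < s) :
    ramanujanPhi (Real.exp (-s)) = ∑' n : ℤ, Real.exp (-s * (n : ℝ) ^ 2) := by
  rw [← (hasSum_ramanujanPhi (norm_exp_neg_lt_one hs)).tsum_eq]
  exact tsum_congr (exp_neg_pow_natAbs_sq s)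

theorem gaussSeries_one_zero {s : ℝ} (hs : 0 < s) :
    gaussSeries s 1 0 = ramanujanPhi (Real.exp (-s)) := by
  simp [gaussSeries, ramanujanPhi_exp_neg hs]

theorem hasSum_gaussSeries {s : ℝ} (hs : 0 < s) {m : ℤ} (hm : m ≠ 0) (a : ℤ) :
    HasSum (fun n : ℤ => Real.exp (-s * ((m * n + a : ℤ) : ℝ) ^ 2)) (gaussSeries s m a) := by
  refine Summable.hasSum ((summable_exp_neg_mul_int_sq hs).comp_injective
    (i := fun n : ℤ => m * n + a) fun n k h => ?_)
  exact mul_left_cancel₀ hm (add_right_cancel h)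

theorem gaussSeries_pos {s : ℝ} (hs : 0 < s) {m : ℤ} (hm : m ≠ 0) (a : ℤ) :
    0 < gaussSeries s m a :=
  (hasSum_gaussSeries hs hm a).summable.tsum_pos (fun _ => (Real.exp_pos _).le) 0 (Real.exp_pos _)

theorem gaussSeries_add_period (s : ℝ) (m a : ℤ) :
    gaussSeries s m (a + m) = gaussSeries s m a := by
  unfold gaussSeries
  rw [← (Equiv.addRight (1 : ℤ)).tsum_eq fun n : ℤ => Real.exp (-s * ((m * n + a : ℤ) : ℝ) ^ 2)]
  refine tsum_congr fun n => ?_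
  rw [Equiv.coe_addRight, show m * (n + 1) + a = m * n + (a + m) by ring]

theorem gaussSeries_neg (s : ℝ) (m a : ℤ) : gaussSeries s m (-a) = gaussSeries s m a := by
  unfold gaussSeries
  rw [← (Equiv.neg ℤ).tsum_eq]
  refine tsum_congr fun n => ?_
  rw [Equiv.neg_apply, show m * -n + -a = -(m * n + a) by ring, Int.cast_neg, neg_sq]

theorem gaussSeries_add_mul_period (s : ℝ) (m a k : ℤ) :
    gaussSeries s m (a + k * m) = gaussSeries s m a := by
  induction k using Int.induction_on with
  | zero => simp
  | succ k ih => rw [← ih, ← gaussSeries_add_period s m (a + k * m)]; congr 1; ring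
  | pred k ih => rw [← ih, ← gaussSeries_add_period s m (a + (-k - 1) * m)]; congr 1; ring

theorem gaussSeries_congr (s : ℝ) {m a b : ℤ} (h : a ≡ b [ZMOD m]) :
    gaussSeries s m a = gaussSeries s m b := by
  obtain ⟨k, hk⟩ := h.symm.dvd
  rw [← gaussSeries_add_mul_period s m b k]
  congr 1
  linarith

theorem gaussSeries_congr_neg (s : ℝ) {m a b : ℤ} (h : a ≡ -b [ZMOD m]) :
    gaussSeries s m a = gaussSeries s m b := by
  rw [gaussSeries_congr s h, gaussSeries_neg]

theorem gaussSeries_mul_zero (s : ℝ) (m : ℤ) :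
    gaussSeries s m 0 = gaussSeries (m ^ 2 * s) 1 0 := by
  refine tsum_congr fun n => ?_
  push_cast
  ring_nf

/-! ### Products of Gaussian sums and lattice dissections -/

theorem HasSum.mul_of_forall_nonneg {ι κ : Type*} {f : ι → ℝ} {g : κ → ℝ} {a b : ℝ}
    (hf : HasSum f a) (hg : HasSum g b) (hf₀ : ∀ i, 0 ≤ f i) (hg₀ : ∀ k, 0 ≤ g k) :
    HasSum (fun p : ι × κ => f p.1 * g p.2) (a * b) :=
  hf.mul hg (hf.summable.mul_of_nonneg hg.summable hf₀ hg₀)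

theorem hasSum_gaussSeries_mul {s : ℝ} (hs : 0 < s) {m : ℤ} (hm : m ≠ 0) (a b : ℤ) :
    HasSum (fun p : ℤ × ℤ => Real.exp (-s * ((m * p.1 + a : ℤ) : ℝ) ^ 2) *
      Real.exp (-s * ((m * p.2 + b : ℤ) : ℝ) ^ 2)) (gaussSeries s m a * gaussSeries s m b) :=
  (hasSum_gaussSeries hs hm a).mul_of_forall_nonneg (hasSum_gaussSeries hs hm b)
    (fun _ => (Real.exp_pos _).le) fun _ => (Real.exp_pos _).le

/-- A sum over `γ` computed along a partition of `γ` into finitely many copies of `β`. -/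
theorem tsum_eq_sum_tsum_of_bijective {ι β γ : Type*} [Fintype ι] {f : γ → ℝ} (hf : Summable f)
    {e : ι × β → γ} (he : Function.Bijective e) :
    ∑' c, f c = ∑ i, ∑' b, f (e (i, b)) := by
  rw [← (Equiv.ofBijective e he).tsum_eq f]
  have hs : Summable fun p => f (Equiv.ofBijective e he p) := (Equiv.summable_iff _).mpr hf
  rw [hs.tsum_prod, tsum_fintype]
  rfl

theorem gaussSeries_dissection_seven {s : ℝ} (hs : 0 < s) :
    gaussSeries s 1 0 = ∑ a : Fin 7, gaussSeries s 7 (a : ℕ) := by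
  refine tsum_eq_sum_tsum_of_bijective (hasSum_gaussSeries hs one_ne_zero 0).summable
    (e := fun p : Fin 7 × ℤ => 7 * p.2 + ((p.1 : ℕ) : ℤ)) ⟨?_, ?_⟩ |>.trans ?_
  · rintro ⟨a, n⟩ ⟨b, k⟩ h
    simp only [Prod.mk.injEq, Fin.ext_iff] at h ⊢
    omega
  · intro n
    refine ⟨(⟨(n % 7).toNat, by omega⟩, n / 7), ?_⟩
    simp only
    omega
  · simp [gaussSeries]

/-- The product of two Gaussian sums modulo `m`, rewritten by rotating the lattice by `45°`. -/
theorem gaussSeries_mul_gaussSeries {s : ℝ} (hs : 0 < s) {m : ℤ} (hm : m ≠ 0) (a b : ℤ) :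
    gaussSeries s m a * gaussSeries s m b =
      gaussSeries (s / 2) (2 * m) (a + b) * gaussSeries (s / 2) (2 * m) (a - b) +
      gaussSeries (s / 2) (2 * m) (a + b + m) * gaussSeries (s / 2) (2 * m) (a - b + m) := by
  have hs2 : 0 < s / 2 := by positivity
  have hm2 : 2 * m ≠ 0 := by omega
  -- The two branches are the pairs (i, j) with i + j even and odd.
  let e : (ℤ × ℤ) ⊕ (ℤ × ℤ) → ℤ × ℤ :=
    Sum.elim (fun p => (p.1 + p.2, p.1 - p.2)) (fun p => (p.1 + p.2 + 1, p.1 - p.2))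
  have he : Function.Bijective e := by
    constructor
    · rintro (⟨a, b⟩ | ⟨a, b⟩) (⟨c, d⟩ | ⟨c, d⟩) h <;>
        simp only [e, Sum.elim_inl, Sum.elim_inr, Prod.mk.injEq, Sum.inl.injEq, Sum.inr.injEq,
          reduceCtorEq] at h ⊢ <;> omega
    · rintro ⟨i, j⟩
      rcases Int.emod_two_eq_zero_or_one (i + j) with h | h
      · refine ⟨Sum.inl ((i + j) / 2, (i - j) / 2), ?_⟩
        simp only [e, Sum.elim_inl, Prod.mk.injEq]
        omega
      · refine ⟨Sum.inr ((i + j) / 2, (i - j) / 2), ?_⟩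
        simp only [e, Sum.elim_inr, Prod.mk.injEq]
        omega
  refine (hasSum_gaussSeries_mul hs hm a b).unique ?_
  rw [← (Equiv.ofBijective e he).hasSum_iff]
  refine HasSum.sum ?_ ?_
  · convert hasSum_gaussSeries_mul hs2 hm2 (a + b) (a - b) using 2 with p
    simp only [Function.comp_apply, Equiv.ofBijective_apply, e, Sum.elim_inl, ← Real.exp_add]
    push_cast
    ring_nf
  · convert hasSum_gaussSeries_mul hs2 hm2 (a + b + m) (a - b + m) using 2 with p
    simp only [Function.comp_apply, Equiv.ofBijective_apply, e, Sum.elim_inr, ← Real.exp_add]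
    push_cast
    ring_nf

/-- The fourth power of the theta series as a sum over a self-dual code of length four modulo
seven, which comes from multiplying `ℤ⁴` by the Hurwitz quaternion `2 + i + j + k` of norm seven. -/
theorem gaussSeries_pow_four {s : ℝ} (hs : 0 < s) :
    gaussSeries (7 * s) 1 0 ^ 4 = ∑ p : Fin 7 × Fin 7,
      (gaussSeries s 7 (p.1 : ℕ) * gaussSeries s 7 (p.2 : ℕ)) *
      (gaussSeries s 7 (3 * (p.1 : ℕ) + 2 * (p.2 : ℕ)) *
        gaussSeries s 7 (2 * (p.1 : ℕ) - 3 * (p.2 : ℕ))) := by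
  have mulSum : ∀ {t : ℝ} (_ : 0 < t) {l : ℤ} (_ : l ≠ 0) (c₁ c₂ c₃ c₄ : ℤ),
      HasSum (fun p : (ℤ × ℤ) × (ℤ × ℤ) =>
        (Real.exp (-t * ((l * p.1.1 + c₁ : ℤ) : ℝ) ^ 2) *
          Real.exp (-t * ((l * p.1.2 + c₂ : ℤ) : ℝ) ^ 2)) *
        (Real.exp (-t * ((l * p.2.1 + c₃ : ℤ) : ℝ) ^ 2) *
          Real.exp (-t * ((l * p.2.2 + c₄ : ℤ) : ℝ) ^ 2)))
        ((gaussSeries t l c₁ * gaussSeries t l c₂) *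
          (gaussSeries t l c₃ * gaussSeries t l c₄)) :=
    fun ht _ hl c₁ c₂ c₃ c₄ => (hasSum_gaussSeries_mul ht hl c₁ c₂).mul_of_forall_nonneg
      (hasSum_gaussSeries_mul ht hl c₃ c₄)
      (fun _ => mul_nonneg (Real.exp_pos _).le (Real.exp_pos _).le)
      fun _ => mul_nonneg (Real.exp_pos _).le (Real.exp_pos _).le
  have hL := mulSum (show 0 < 7 * s by positivity) one_ne_zero 0 0 0 0
  rw [show gaussSeries (7 * s) 1 0 ^ 4 = gaussSeries (7 * s) 1 0 * gaussSeries (7 * s) 1 0 *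
    (gaussSeries (7 * s) 1 0 * gaussSeries (7 * s) 1 0) by ring, ← hL.tsum_eq]
  -- The linear part M satisfies MᵀM = 7. The shift (a, b, a, -b) is chosen so that Mᵀx = 7n + (a,
  -- b, 3a + 2b, 2a - 3b), and 7|x|² = |Mᵀx|².
  refine tsum_eq_sum_tsum_of_bijective hL.summable
    (e := fun p : (Fin 7 × Fin 7) × ((ℤ × ℤ) × (ℤ × ℤ)) =>
      ((2 * p.2.1.1 + p.2.1.2 + p.2.2.1 + p.2.2.2 + (p.1.1 : ℕ),
        -p.2.1.1 + 2 * p.2.1.2 + p.2.2.1 - p.2.2.2 + (p.1.2 : ℕ)),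
       (-p.2.1.1 - p.2.1.2 + 2 * p.2.2.1 + p.2.2.2 + (p.1.1 : ℕ),
        -p.2.1.1 + p.2.1.2 - p.2.2.1 + 2 * p.2.2.2 - (p.1.2 : ℕ)))) ⟨?_, ?_⟩ |>.trans ?_
  · rintro ⟨⟨a, b⟩, ⟨⟨n₀, n₁⟩, ⟨n₂, n₃⟩⟩⟩ ⟨⟨c, d⟩, ⟨⟨k₀, k₁⟩, ⟨k₂, k₃⟩⟩⟩ h
    simp only [Prod.mk.injEq, Fin.ext_iff] at h ⊢
    omega
  · rintro ⟨⟨x₀, x₁⟩, ⟨x₂, x₃⟩⟩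
    -- The residues of the first two coordinates of Mᵀx determine the codeword.
    obtain ⟨a, ha⟩ : ∃ a : Fin 7, ((a : ℕ) : ℤ) = (2 * x₀ - x₁ - x₂ - x₃) % 7 :=
      ⟨⟨((2 * x₀ - x₁ - x₂ - x₃) % 7).toNat, by omega⟩, by simp only; omega⟩
    obtain ⟨b, hb⟩ : ∃ b : Fin 7, ((b : ℕ) : ℤ) = (x₀ + 2 * x₁ - x₂ + x₃) % 7 :=
      ⟨⟨((x₀ + 2 * x₁ - x₂ + x₃) % 7).toNat, by omega⟩, by simp only; omega⟩
    refine ⟨((a, b), (((2 * x₀ - x₁ - x₂ - x₃) / 7, (x₀ + 2 * x₁ - x₂ + x₃) / 7),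
      ((x₀ + x₁ + 2 * x₂ - x₃ - 3 * (a : ℕ) - 2 * (b : ℕ)) / 7,
        (x₀ - x₁ + x₂ + 2 * x₃ - 2 * (a : ℕ) + 3 * (b : ℕ)) / 7))), ?_⟩
    simp only [Prod.mk.injEq, ha, hb]
    omega
  · refine Finset.sum_congr rfl fun p _ => ?_
    refine Eq.trans (tsum_congr fun n => ?_) (mulSum hs (show (7 : ℤ) ≠ 0 by norm_num)
      (p.1 : ℕ) (p.2 : ℕ) (3 * (p.1 : ℕ) + 2 * (p.2 : ℕ)) (2 * (p.1 : ℕ) - 3 * (p.2 : ℕ))).tsum_eq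
    simp only [← Real.exp_add]
    push_cast
    ring_nf

/-! ### Algebraic relations between the sums modulo seven -/

/-- The Gram determinant of three vectors in the plane vanishes. -/
theorem gram_det_three_eq_zero {R : Type*} [CommRing R]
    {p₁ q₁ p₂ q₂ p₃ q₃ m₁₁ m₁₂ m₁₃ m₂₂ m₂₃ m₃₃ : R}
    (h₁₁ : m₁₁ = p₁ * p₁ + q₁ * q₁) (h₁₂ : m₁₂ = p₁ * p₂ + q₁ * q₂)
    (h₁₃ : m₁₃ = p₁ * p₃ + q₁ * q₃) (h₂₂ : m₂₂ = p₂ * p₂ + q₂ * q₂)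
    (h₂₃ : m₂₃ = p₂ * p₃ + q₂ * q₃) (h₃₃ : m₃₃ = p₃ * p₃ + q₃ * q₃) :
    m₁₁ * (m₂₂ * m₃₃ - m₂₃ ^ 2) - m₁₂ * (m₁₂ * m₃₃ - m₂₃ * m₁₃)
      + m₁₃ * (m₁₂ * m₂₃ - m₂₂ * m₁₃) = 0 := by
  subst h₁₁ h₁₂ h₁₃ h₂₂ h₂₃ h₃₃
  ring

/-- The algebraic relations between the four Gaussian sums modulo seven, normalized by the one
over the multiples of seven. -/
theorem gaussSeries_seven_relations {s : ℝ} (hs : 0 < s) {x y z : ℝ}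
    (hx : gaussSeries s 7 1 = x * gaussSeries s 7 0)
    (hy : gaussSeries s 7 2 = y * gaussSeries s 7 0)
    (hz : gaussSeries s 7 3 = z * gaussSeries s 7 0) :
    x * y - y ^ 2 * z ^ 2 - y * z ^ 4 + 2 * x ^ 2 * y * z ^ 3 - x ^ 5 = 0 ∧
    y * z - z ^ 2 * x ^ 2 - z * x ^ 4 + 2 * y ^ 2 * z * x ^ 3 - y ^ 5 = 0 ∧
    z * x - x ^ 2 * y ^ 2 - x * y ^ 4 + 2 * z ^ 2 * x * y ^ 3 - z ^ 5 = 0 ∧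
    x ^ 2 * y ^ 3 + y ^ 2 * z ^ 3 + z ^ 2 * x ^ 3 = x * y * z + 2 * (x * y * z) ^ 2 := by
  have ht := (gaussSeries_pos hs (show (7 : ℤ) ≠ 0 by norm_num) 0).ne'
  have h := gaussSeries_mul_gaussSeries hs (show (7 : ℤ) ≠ 0 by norm_num)
  have e8 : gaussSeries (s / 2) 14 8 = gaussSeries (s / 2) 14 6 := gaussSeries_congr_neg _ rfl
  have e9 : gaussSeries (s / 2) 14 9 = gaussSeries (s / 2) 14 5 := gaussSeries_congr_neg _ rfl
  have e10 : gaussSeries (s / 2) 14 10 = gaussSeries (s / 2) 14 4 := gaussSeries_congr_neg _ rfl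
  have e11 : gaussSeries (s / 2) 14 11 = gaussSeries (s / 2) 14 3 := gaussSeries_congr_neg _ rfl
  have e12 : gaussSeries (s / 2) 14 12 = gaussSeries (s / 2) 14 2 := gaussSeries_congr_neg _ rfl
  have e13 : gaussSeries (s / 2) 14 13 = gaussSeries (s / 2) 14 1 := gaussSeries_congr_neg _ rfl
  have h00 := h 0 0
  have h11 := h 1 1
  have h22 := h 2 2
  have h33 := h 3 3
  have h10 := h 1 0
  have h20 := h 2 0
  have h30 := h 3 0
  have h32 := h 3 2
  have h21 := h 2 1
  have h31 := h 3 1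
  norm_num [hx, hy, hz, e8, e9, e10, e11, e12, e13] at h00 h11 h22 h33 h10 h20 h30 h32 h21 h31
  generalize gaussSeries s 7 0 = t at *
  generalize gaussSeries (s / 2) 14 0 = a0 at *
  generalize gaussSeries (s / 2) 14 1 = a1 at *
  generalize gaussSeries (s / 2) 14 2 = a2 at *
  generalize gaussSeries (s / 2) 14 3 = a3 at *
  generalize gaussSeries (s / 2) 14 4 = a4 at *
  generalize gaussSeries (s / 2) 14 5 = a5 at *
  generalize gaussSeries (s / 2) 14 6 = a6 at *
  generalize gaussSeries (s / 2) 14 7 = a7 at *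
  have ht6 : t ^ 6 ≠ 0 := pow_ne_zero 6 ht
  rw [mul_comm a2 a0, mul_comm a5 a7] at h11
  rw [mul_comm a4 a0, mul_comm a3 a7] at h22
  rw [mul_comm a6 a0, mul_comm a1 a7] at h33
  -- The vectors (a0, a7), (a6, a1), (a2, a5), (a4, a3) have inner products θ_i θ_j. The four
  -- relations are the principal 3×3 minors, homogeneous of degree 6 in the θ's.
  refine ⟨mul_left_cancel₀ ht6 ?_, mul_left_cancel₀ ht6 ?_, mul_left_cancel₀ ht6 ?_,
    mul_left_cancel₀ ht6 ?_⟩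
  · linear_combination gram_det_three_eq_zero h00 h33 h11 (h10.trans (add_comm _ _))
      (h32.trans (by ring : _ = a6 * a2 + a1 * a5)) h20
  · linear_combination gram_det_three_eq_zero h00 h11 h22 h20
      (h31.trans (by ring : _ = a2 * a4 + a5 * a3)) (h30.trans (add_comm _ _))
  · linear_combination gram_det_three_eq_zero h00 h33 h22 (h10.trans (add_comm _ _))
      (h21.trans (by ring : _ = a6 * a4 + a1 * a3)) (h30.trans (add_comm _ _))
  · linear_combination -gram_det_three_eq_zero (h10.trans (add_comm _ _))
      (h32.trans (by ring : _ = a6 * a2 + a1 * a5)) (h21.trans (by ring : _ = a6 * a4 + a1 * a3))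
      h20 (h31.trans (by ring : _ = a2 * a4 + a5 * a3)) (h30.trans (add_comm _ _))

/-- The 49 codewords, sorted by their entries up to sign, split as 1 + 24 + 8 · 3. -/
theorem gaussSeries_pow_four_eq {s : ℝ} (hs : 0 < s) :
    gaussSeries (7 * s) 1 0 ^ 4 = gaussSeries s 7 0 ^ 4 +
      24 * gaussSeries s 7 0 * gaussSeries s 7 1 * gaussSeries s 7 2 * gaussSeries s 7 3 +
      8 * (gaussSeries s 7 1 ^ 3 * gaussSeries s 7 2 + gaussSeries s 7 2 ^ 3 * gaussSeries s 7 3 +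
        gaussSeries s 7 3 ^ 3 * gaussSeries s 7 1) := by
  have h : ∀ a : ℤ, gaussSeries s 7 a = gaussSeries s 7 (a % 7) := fun a =>
    gaussSeries_congr s (Int.mod_modEq a 7).symm
  have e4 : gaussSeries s 7 4 = gaussSeries s 7 3 := gaussSeries_congr_neg _ rfl
  have e5 : gaussSeries s 7 5 = gaussSeries s 7 2 := gaussSeries_congr_neg _ rfl
  have e6 : gaussSeries s 7 6 = gaussSeries s 7 1 := gaussSeries_congr_neg _ rfl
  rw [gaussSeries_pow_four hs, Fintype.sum_prod_type]
  simp only [h (3 * _ + _), h (2 * _ - _), Fin.sum_univ_seven, Fin.isValue, Fin.coe_ofNat_eq_mod]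
  norm_num [e4, e5, e6]
  ring

theorem gaussSeries_one_zero_eq {s : ℝ} (hs : 0 < s) :
    gaussSeries s 1 0 = gaussSeries s 7 0 +
      2 * (gaussSeries s 7 1 + gaussSeries s 7 2 + gaussSeries s 7 3) := by
  have e4 : gaussSeries s 7 4 = gaussSeries s 7 3 := gaussSeries_congr_neg _ rfl
  have e5 : gaussSeries s 7 5 = gaussSeries s 7 2 := gaussSeries_congr_neg _ rfl
  have e6 : gaussSeries s 7 6 = gaussSeries s 7 1 := gaussSeries_congr_neg _ rfl
  rw [gaussSeries_dissection_seven hs]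
  simp [Fin.sum_univ_seven, e4, e5, e6]
  ring

/-! ### Solving the relations in terms of cosines -/

/-- The solution of the normalized septic relations at the value `7` of `(φ(q) / φ(q⁷))⁴`. -/
theorem septic_relations_solution {x y z : ℝ} (hx : 0 < x) (hy : 0 < y) (hz : 0 < z)
    (h₁ : x * y - y ^ 2 * z ^ 2 - y * z ^ 4 + 2 * x ^ 2 * y * z ^ 3 - x ^ 5 = 0)
    (h₂ : y * z - z ^ 2 * x ^ 2 - z * x ^ 4 + 2 * y ^ 2 * z * x ^ 3 - y ^ 5 = 0)
    (h₃ : z * x - x ^ 2 * y ^ 2 - x * y ^ 4 + 2 * z ^ 2 * x * y ^ 3 - z ^ 5 = 0)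
    (h₄ : x ^ 2 * y ^ 3 + y ^ 2 * z ^ 3 + z ^ 2 * x ^ 3 = x * y * z + 2 * (x * y * z) ^ 2)
    (h₅ : 1 + 24 * (x * y * z) + 8 * (x ^ 3 * y + y ^ 3 * z + z ^ 3 * x) = 7) :
    x * y * z = 1 / 8 := by
  have hP : 0 < x * y * z := by positivity
  -- Cyclic sum of xy² · `h₁`, which depends only on xyz, Σx³y and Σx²y³; `h₄` eliminates the last.
  have hQ : (x ^ 3 * y + y ^ 3 * z + z ^ 3 * x) ^ 2
      + (x * y * z) * (x ^ 3 * y + y ^ 3 * z + z ^ 3 * x)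
      = (x * y * z) * (1 + 3 * (x * y * z) + 8 * (x * y * z) ^ 2) := by
    refine mul_left_cancel₀ hP.ne' ?_
    linear_combination -(x ^ 2 * y ^ 3 * z) * h₁ - (y ^ 2 * z ^ 3 * x) * h₂
      - (z ^ 2 * x ^ 3 * y) * h₃ + (x * y * z) * (1 + x * y * z) * h₄
  have hS : x ^ 3 * y + y ^ 3 * z + z ^ 3 * x = 3 / 4 - 3 * (x * y * z) := by linarith
  rw [hS] at hQ
  generalize x * y * z = P at *
  have h : (1 - 8 * P) * (P ^ 2 - P / 4 + 9 / 16) = 0 := by linear_combination hQ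
  rcases mul_eq_zero.mp h with h | h
  · linarith
  · nlinarith [sq_nonneg (P - 1 / 8)]

/-- For θ = π/7, cos 4θ = -cos 3θ is a quartic in cos θ with the spurious factor cos θ + 1. -/
theorem two_mul_cos_pi_div_seven_cubic :
    (2 * Real.cos (Real.pi / 7)) ^ 3 - (2 * Real.cos (Real.pi / 7)) ^ 2
      - 2 * (2 * Real.cos (Real.pi / 7)) + 1 = 0 := by
  have h₃ := Real.cos_three_mul (Real.pi / 7)
  have h₄ : Real.cos (4 * (Real.pi / 7)) = 2 * (2 * Real.cos (Real.pi / 7) ^ 2 - 1) ^ 2 - 1 := by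
    rw [← Real.cos_two_mul, ← Real.cos_two_mul]
    ring_nf
  have h : Real.cos (4 * (Real.pi / 7)) = -Real.cos (3 * (Real.pi / 7)) := by
    rw [← Real.cos_pi_sub]
    ring_nf
  have hc : 0 < Real.cos (Real.pi / 7) := Real.cos_pos_of_mem_Ioo
    ⟨by linarith [Real.pi_pos], by linarith [Real.pi_pos]⟩
  rw [h₄, h₃] at h
  refine mul_left_cancel₀ (show Real.cos (Real.pi / 7) + 1 ≠ 0 by positivity) ?_
  linear_combination h

/-- A solution of a cyclic cubic system is determined by one of its entries. -/
theorem septic_cubic_next_eq {a b g b' g' : ℝ} (hs : a + b + g = 6) (hp : a * b * g = 1)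
    (h : 8 * a * b - 2 * b - b * g + 1 - a ^ 2 = 0) (hs' : a + b' + g' = 6)
    (hp' : a * b' * g' = 1) (h' : 8 * a * b' - 2 * b' - b' * g' + 1 - a ^ 2 = 0)
    (hr : a ^ 3 - 6 * a ^ 2 + 5 * a - 1 = 0) : b = b' ∧ g = g' := by
  -- Since abg = 1, a times `h` is linear in b with this leading coefficient.
  have ha : a * (8 * a - 2) ≠ 0 := by
    intro h0
    rcases mul_eq_zero.mp h0 with h1 | h1
    · norm_num [h1] at hr
    · norm_num [show a = 1 / 4 by linarith] at hr
  have hb : b = b' := mul_left_cancel₀ ha (by linear_combination a * h - a * h' + hp - hp')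
  exact ⟨hb, by linarith⟩

theorem rpow_two_div_seven_eq {k u : ℝ} (hk : 0 < k) (hu : 0 < u) (h : u ^ 7 = k ^ 2) :
    k ^ (2 / 7 : ℝ) = u := by
  rw [show (2 / 7 : ℝ) = ((2 : ℕ) : ℝ) * ((7 : ℕ) : ℝ)⁻¹ by norm_num, Real.rpow_mul hk.le, Real.rpow_natCast,
    ← h, Real.pow_rpow_inv_natCast hu.le (by norm_num)]

/-- When uvw = 1/8, (2u)⁷ = (16u³v)²/(16v³w), so the cyclic monomials determine each variable. -/
theorem add_eq_add_rpow_of_cyclic {c₁ c₂ c₃ x y z : ℝ} (h₁ : 0 < c₁) (h₂ : 0 < c₂) (h₃ : 0 < c₃)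
    (hx : 0 < x) (hy : 0 < y) (hz : 0 < z) (hP : x * y * z = 1 / 8)
    (ha : 16 * (x ^ 3 * y) = 1 / (4 * c₃ ^ 2)) (hb : 16 * (y ^ 3 * z) = 1 / (4 * c₂ ^ 2))
    (hg : 16 * (z ^ 3 * x) = 1 / (4 * c₁ ^ 2)) :
    2 * (x + y + z) = (c₁ / (2 * c₂ ^ 2)) ^ (2 / 7 : ℝ) + (c₂ / (2 * c₃ ^ 2)) ^ (2 / 7 : ℝ)
      + (c₃ / (2 * c₁ ^ 2)) ^ (2 / 7 : ℝ) := by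
  have key : ∀ {u v w d e : ℝ}, 0 < u → 0 < v → 0 < w → 0 < d → 0 < e → u * v * w = 1 / 8 →
      16 * (u ^ 3 * v) = 1 / (4 * e ^ 2) → 16 * (v ^ 3 * w) = 1 / (4 * d ^ 2) →
      (d / (2 * e ^ 2)) ^ (2 / 7 : ℝ) = 2 * u := by
    intro u v w d e hu hv hw hd he hP hue hvd
    refine rpow_two_div_seven_eq (by positivity) (by positivity) ?_
    have h : (2 * u) ^ 7 * (16 * (v ^ 3 * w)) = (16 * (u ^ 3 * v)) ^ 2 := by
      linear_combination (2048 * u ^ 6 * v ^ 2) * hP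
    rw [hue, hvd] at h
    field_simp at h ⊢
    linear_combination h
  rw [key hx hy hz h₂ h₃ hP ha hb, key hy hz hx h₁ h₂ (by linarith) hb hg,
    key hz hx hy h₃ h₁ (by linarith) hg ha]
  ring

theorem add_eq_add_rpow_cos {x y z : ℝ} (hx : 0 < x) (hy : 0 < y) (hz : 0 < z)
    (h₁ : x * y - y ^ 2 * z ^ 2 - y * z ^ 4 + 2 * x ^ 2 * y * z ^ 3 - x ^ 5 = 0)
    (h₂ : y * z - z ^ 2 * x ^ 2 - z * x ^ 4 + 2 * y ^ 2 * z * x ^ 3 - y ^ 5 = 0)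
    (h₃ : z * x - x ^ 2 * y ^ 2 - x * y ^ 4 + 2 * z ^ 2 * x * y ^ 3 - z ^ 5 = 0)
    (h₄ : x ^ 2 * y ^ 3 + y ^ 2 * z ^ 3 + z ^ 2 * x ^ 3 = x * y * z + 2 * (x * y * z) ^ 2)
    (h₅ : 1 + 24 * (x * y * z) + 8 * (x ^ 3 * y + y ^ 3 * z + z ^ 3 * x) = 7) :
    2 * (x + y + z) =
      (Real.cos (Real.pi / 7) / (2 * Real.cos (2 * Real.pi / 7) ^ 2)) ^ (2 / 7 : ℝ)
      + (Real.cos (2 * Real.pi / 7) / (2 * Real.cos (3 * Real.pi / 7) ^ 2)) ^ (2 / 7 : ℝ)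
      + (Real.cos (3 * Real.pi / 7) / (2 * Real.cos (Real.pi / 7) ^ 2)) ^ (2 / 7 : ℝ) := by
  have hP := septic_relations_solution hx hy hz h₁ h₂ h₃ h₄ h₅
  have hc := two_mul_cos_pi_div_seven_cubic
  have hc₂ : Real.cos (2 * Real.pi / 7) = 2 * Real.cos (Real.pi / 7) ^ 2 - 1 := by
    rw [← Real.cos_two_mul]; ring_nf
  have hc₃ : Real.cos (3 * Real.pi / 7) = 4 * Real.cos (Real.pi / 7) ^ 3
      - 3 * Real.cos (Real.pi / 7) := by
    rw [← Real.cos_three_mul]; ring_nf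
  have pos : ∀ {t : ℝ}, 0 < t → t < Real.pi / 2 → 0 < Real.cos t := fun h h' =>
    Real.cos_pos_of_mem_Ioo ⟨by linarith, h'⟩
  have p₁ : 0 < Real.cos (Real.pi / 7) := pos (by positivity) (by linarith [Real.pi_pos])
  have p₂ : 0 < Real.cos (2 * Real.pi / 7) := pos (by positivity) (by linarith [Real.pi_pos])
  have p₃ : 0 < Real.cos (3 * Real.pi / 7) := pos (by positivity) (by linarith [Real.pi_pos])
  generalize Real.cos (Real.pi / 7) = c₁ at *
  generalize Real.cos (2 * Real.pi / 7) = c₂ at *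
  generalize Real.cos (3 * Real.pi / 7) = c₃ at *
  obtain ⟨r₁, hr₁⟩ : ∃ r, r = 1 / (4 * c₁ ^ 2) := ⟨_, rfl⟩
  obtain ⟨r₂, hr₂⟩ : ∃ r, r = 1 / (4 * c₂ ^ 2) := ⟨_, rfl⟩
  obtain ⟨r₃, hr₃⟩ : ∃ r, r = 1 / (4 * c₃ ^ 2) := ⟨_, rfl⟩
  have q₁ : r₁ * (4 * c₁ ^ 2) = 1 := by rw [hr₁]; field_simp
  have q₂ : r₂ * (4 * c₂ ^ 2) = 1 := by rw [hr₂]; field_simp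
  have q₃ : r₃ * (4 * c₃ ^ 2) = 1 := by rw [hr₃]; field_simp
  have hsum : r₃ + r₂ + r₁ = 6 := by grind
  have hpair : r₃ * r₂ + r₂ * r₁ + r₁ * r₃ = 5 := by grind
  have hprod : r₃ * r₂ * r₁ = 1 := by grind
  have k₁ : 8 * r₃ * r₂ - 2 * r₂ - r₂ * r₁ + 1 - r₃ ^ 2 = 0 := by grind
  have k₂ : 8 * r₂ * r₁ - 2 * r₁ - r₁ * r₃ + 1 - r₂ ^ 2 = 0 := by grind
  have k₃ : 8 * r₁ * r₃ - 2 * r₃ - r₃ * r₂ + 1 - r₁ ^ 2 = 0 := by grind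
  have asum : 16 * (x ^ 3 * y) + 16 * (y ^ 3 * z) + 16 * (z ^ 3 * x) = 6 := by linarith
  have apair : 16 * (x ^ 3 * y) * (16 * (y ^ 3 * z)) + 16 * (y ^ 3 * z) * (16 * (z ^ 3 * x))
      + 16 * (z ^ 3 * x) * (16 * (x ^ 3 * y)) = 5 := by
    have : x ^ 2 * y ^ 3 + y ^ 2 * z ^ 3 + z ^ 2 * x ^ 3 = 5 / 32 := by rw [h₄, hP]; norm_num
    linear_combination 256 * (x * y * z) * this + 40 * hP
  have aprod : 16 * (x ^ 3 * y) * (16 * (y ^ 3 * z)) * (16 * (z ^ 3 * x)) = 1 := by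
    rw [show 16 * (x ^ 3 * y) * (16 * (y ^ 3 * z)) * (16 * (z ^ 3 * x)) = 4096 * (x * y * z) ^ 4
      by ring, hP]
    norm_num
  -- This is 256xy² · `h₁` with xyz = 1/8.
  have l₁ : 8 * (16 * (x ^ 3 * y)) * (16 * (y ^ 3 * z)) - 2 * (16 * (y ^ 3 * z))
      - 16 * (y ^ 3 * z) * (16 * (z ^ 3 * x)) + 1 - (16 * (x ^ 3 * y)) ^ 2 = 0 := by
    grind
  have hroot : ∀ r, (r = r₁ ∨ r = r₂ ∨ r = r₃) → r ^ 3 - 6 * r ^ 2 + 5 * r - 1 = 0 := by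
    rintro r (rfl | rfl | rfl)
    · linear_combination r ^ 2 * hsum - r * hpair + hprod
    · linear_combination r ^ 2 * hsum - r * hpair + hprod
    · linear_combination r ^ 2 * hsum - r * hpair + hprod
  have hmem : (16 * (x ^ 3 * y) - r₃) *
      ((16 * (x ^ 3 * y) - r₂) * (16 * (x ^ 3 * y) - r₁)) = 0 := by
    generalize 16 * (x ^ 3 * y) = a at *
    generalize 16 * (y ^ 3 * z) = b at *
    generalize 16 * (z ^ 3 * x) = g at *
    linear_combination (-a ^ 2) * hsum + a * hpair - hprod + a ^ 2 * asum - a * apair + aprod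
  -- The three possible values of 16x³y correspond to the cyclic shifts of (x, y, z), all with the
  -- same sum.
  rcases mul_eq_zero.mp hmem with h | h
  · have ha := sub_eq_zero.mp h
    obtain ⟨hb, hg⟩ := septic_cubic_next_eq (ha ▸ asum) (ha ▸ aprod) (ha ▸ l₁) hsum hprod k₁
      (hroot _ (by simp))
    exact add_eq_add_rpow_of_cyclic p₁ p₂ p₃ hx hy hz hP (ha.trans hr₃) (hb.trans hr₂)
      (hg.trans hr₁)
  rcases mul_eq_zero.mp h with h | h
  · have ha := sub_eq_zero.mp h
    obtain ⟨hb, hg⟩ := septic_cubic_next_eq (ha ▸ asum) (ha ▸ aprod) (ha ▸ l₁)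
      (show r₂ + r₁ + r₃ = 6 by linarith) (show r₂ * r₁ * r₃ = 1 by linarith) k₂
      (hroot _ (by simp))
    have := add_eq_add_rpow_of_cyclic p₁ p₂ p₃ hz hx hy (by linarith) (hg.trans hr₃) (ha.trans hr₂)
      (hb.trans hr₁)
    linarith
  · have ha := sub_eq_zero.mp h
    obtain ⟨hb, hg⟩ := septic_cubic_next_eq (ha ▸ asum) (ha ▸ aprod) (ha ▸ l₁)
      (show r₁ + r₃ + r₂ = 6 by linarith) (show r₁ * r₃ * r₂ = 1 by linarith) k₃
      (hroot _ (by simp))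
    have := add_eq_add_rpow_of_cyclic p₁ p₂ p₃ hy hz hx (by linarith) (hb.trans hr₃)
      (hg.trans hr₂) (ha.trans hr₁)
    linarith

/-! ### Inversion and the final evaluation -/

/-- The inversion formula `φ(e^{-πt}) = t^{-1/2} φ(e^{-π/t})`. -/
theorem ramanujanPhi_inversion {t : ℝ} (ht : 0 < t) :
    ramanujanPhi (Real.exp (-(Real.pi * t))) =
      t ^ (-(1 / 2) : ℝ) * ramanujanPhi (Real.exp (-(Real.pi / t))) := by
  rw [ramanujanPhi_exp_neg (by positivity), ramanujanPhi_exp_neg (by positivity),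
    Real.rpow_neg ht.le, ← one_div]
  simpa only [neg_mul, neg_div] using Real.tsum_exp_neg_mul_int_sq ht

theorem mainTheorem1 :
    ramanujanPhi (Real.exp (-7 * Real.pi * √7)) =
      (7 : ℝ) ^ (-(3 / 4) : ℝ) * ramanujanPhi (Real.exp (-Real.pi * √7)) *
        (1
          + (Real.cos (Real.pi / 7) / (2 * Real.cos (2 * Real.pi / 7) ^ 2)) ^ (2 / 7 : ℝ)
          + (Real.cos (2 * Real.pi / 7) / (2 * Real.cos (3 * Real.pi / 7) ^ 2)) ^ (2 / 7 : ℝ)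
          + (Real.cos (3 * Real.pi / 7) / (2 * Real.cos (Real.pi / 7) ^ 2)) ^ (2 / 7 : ℝ)) := by
  have h7 : (0 : ℝ) < √7 := by positivity
  have hsq : √7 ^ 2 = (7 : ℝ) := Real.sq_sqrt (by norm_num)
  -- With this s, 49s = π√7, while 7s = π/√7 is its image under inversion.
  obtain ⟨s, hs_def⟩ : ∃ s, s = Real.pi / (7 * √7) := ⟨_, rfl⟩
  have hs : 0 < s := by rw [hs_def]; positivity
  have hθ : gaussSeries s 7 0 = ramanujanPhi (Real.exp (-Real.pi * √7)) := by
    rw [gaussSeries_mul_zero, gaussSeries_one_zero (by positivity), hs_def]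
    congr 2
    field_simp
    push_cast
    linear_combination 7 * hsq
  have hφ : ramanujanPhi (Real.exp (-7 * Real.pi * √7)) =
      (7 : ℝ) ^ (-(3 / 4) : ℝ) * gaussSeries s 1 0 := by
    rw [show -7 * Real.pi * √7 = -(Real.pi * (7 * √7)) by ring,
      ramanujanPhi_inversion (by positivity), ← hs_def, gaussSeries_one_zero hs]
    congr 1
    rw [Real.sqrt_eq_rpow, show (7 : ℝ) * 7 ^ (1 / 2 : ℝ) = 7 ^ (3 / 2 : ℝ) by
      rw [show (3 / 2 : ℝ) = 1 + 1 / 2 by norm_num, Real.rpow_add (by norm_num), Real.rpow_one],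
      ← Real.rpow_mul (by norm_num)]
    norm_num
  have h4 : gaussSeries (7 * s) 1 0 ^ 4 = 7 * gaussSeries s 7 0 ^ 4 := by
    have hinv := ramanujanPhi_inversion h7
    rw [show -(Real.pi * √7) = -Real.pi * √7 by ring, ← hθ,
      show Real.pi / √7 = 7 * s by rw [hs_def]; field_simp,
      ← gaussSeries_one_zero (by positivity)] at hinv
    rw [hinv, mul_pow, ← Real.rpow_mul_natCast h7.le,
      show (-(1 / 2) * (4 : ℕ) : ℝ) = -(2 : ℕ) by norm_num, Real.rpow_neg h7.le,
      Real.rpow_natCast, hsq]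
    ring
  have pos := gaussSeries_pos hs (show (7 : ℤ) ≠ 0 by norm_num)
  have ht := (pos 0).ne'
  obtain ⟨x, hx⟩ : ∃ x, x = gaussSeries s 7 1 / gaussSeries s 7 0 := ⟨_, rfl⟩
  obtain ⟨y, hy⟩ : ∃ y, y = gaussSeries s 7 2 / gaussSeries s 7 0 := ⟨_, rfl⟩
  obtain ⟨z, hz⟩ : ∃ z, z = gaussSeries s 7 3 / gaussSeries s 7 0 := ⟨_, rfl⟩
  have hx' := (eq_div_iff ht).mp hx
  have hy' := (eq_div_iff ht).mp hy
  have hz' := (eq_div_iff ht).mp hz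
  obtain ⟨h₁, h₂, h₃, h₄⟩ := gaussSeries_seven_relations hs hx'.symm hy'.symm hz'.symm
  have h₅ : 1 + 24 * (x * y * z) + 8 * (x ^ 3 * y + y ^ 3 * z + z ^ 3 * x) = 7 := by
    rw [gaussSeries_pow_four_eq hs, ← hx', ← hy', ← hz'] at h4
    refine mul_left_cancel₀ (pow_ne_zero 4 ht) ?_
    linear_combination h4
  have key := add_eq_add_rpow_cos (hx ▸ div_pos (pos 1) (pos 0)) (hy ▸ div_pos (pos 2) (pos 0))
    (hz ▸ div_pos (pos 3) (pos 0)) h₁ h₂ h₃ h₄ h₅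
  rw [hφ, gaussSeries_one_zero_eq hs, ← hx', ← hy', ← hz', ← hθ]
  linear_combination ((7 : ℝ) ^ (-(3 / 4) : ℝ) * gaussSeries s 7 0) * key
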